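/- Call a subset $X$ of a metric space $Z$ a separated net if there are constants $a, b > 0$ such that $d(x,x') > a$ for all distinct $x, x' \in X$, and $d(z,X) < b$ for every $z \in Z$. Call two metric spaces $X$ and $Y$ biLipschitz equivalent if there are a bijection $f : X \to Y$ and a constant $K \ge 1$ such that $K^{-1} d(x,y) \le d(f(x),f(y)) \le K\, d(x,y)$ for all $x, y \in X$. Theorem. There exists a separated net in the Euclidean plane $\mathbb{E}^2$ which is not biLipschitz equivalent to the integer lattice $\mathbb{Z}^2 \subset \mathbb{E}^2$ (both sets carrying the metric induced from $\mathbb{E}^2$). -/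

import Mathlib

open scoped NNReal

/-- A subset `X` of a metric space `Z` is a *separated net* if there are `a, b > 0` such that
distinct points of `X` are at distance `> a` and every point of `Z` is at distance `< b` from `X`,
that is, from some point of `X`. -/
def IsSeparatedNet {Z : Type*} [MetricSpace Z] (X : Set Z) : Prop :=
  ∃ a b : ℝ, 0 < a ∧ 0 < b ∧
    (∀ x ∈ X, ∀ x' ∈ X, x ≠ x' → a < dist x x') ∧
    (∀ z : Z, ∃ x ∈ X, dist z x < b)

/-- Two metric spaces are *biLipschitz equivalent* if there is a bijection between them which is
Lipschitz with Lipschitz inverse, i.e. `d(x, y) / K ≤ d(f x, f y) ≤ K d(x, y)` for some `K`. -/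
def BiLipschitzEquivalent (X Y : Type*) [MetricSpace X] [MetricSpace Y] : Prop :=
  ∃ (f : X ≃ Y) (K : ℝ≥0), LipschitzWith K f ∧ AntilipschitzWith K f

/-- The integer lattice `ℤ²`, as a subset of the Euclidean plane. -/
def integerLattice : Set (EuclideanSpace ℝ (Fin 2)) :=
  {x | ∀ i, ∃ n : ℤ, x i = n}

/-! The net has rows whose density alternates between 1/2 and 1 on intervals of length `r n`.
Suppose a K-biLipschitz bijection G onto the lattice exists. Take a pair in one row, at a distance
much larger than s, that G stretches by A. Either some nearby pair at distance s is stretched by at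
least (1 + κ)A, or almost all s-steps have nearly the same image vector. In the second case G
carries some dense s-square close to a translate of the image of the adjacent sparse square.
Translating back by a lattice vector and applying the inverse of G puts about s² net points near a
square that holds about s²/2, which is absurd (`IsLatticeParam.false_of_translated_square`). So the
stretch grows by 1 + κ at each descent in scale (`IsLatticeParam.exists_more_stretched`), from at
least 1/K until it exceeds K. Since κ and the number of scales depend on K, the rows must carry
arbitrarily many scales: `digitPeriod` interleaves them, and `exists_word_containing` places every
base in one net. -/

/-- If rows of `2 * N` vectors of norm at most `B` have sums whose `u`-components are nearly maximal,
then for some even index most of the vectors at that index are close to `B • u`. -/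
lemma exists_even_index_near {ι E : Type*} [NormedAddCommGroup E] [InnerProductSpace ℝ E]
    (P : Finset ι) (w : ℕ → ι → E) (u : E) (hu : ‖u‖ = 1) {B Δ ε : ℝ} {N : ℕ} (hN : 0 < N)
    (hw : ∀ i, ∀ x ∈ P, ‖w i x‖ ≤ B)
    (hsum : ∀ x ∈ P, 2 * N * B - Δ ≤ inner ℝ u (∑ i ∈ Finset.range (2 * N), w i x)) :
    ∃ i < N, ((P.filter fun x => 2 * B * ε < ‖w (2 * i) x - B • u‖ ^ 2).card : ℝ) * (N * ε)
      ≤ P.card * Δ := by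
  set d : ℕ → ι → ℝ := fun i x => B - inner ℝ u (w i x) with hd
  have hd0 : ∀ i, ∀ x ∈ P, 0 ≤ d i x := by
    intro i x hx
    have h1 := real_inner_le_norm u (w i x)
    rw [hu, one_mul] at h1
    have := hw i x hx
    simp only [hd]; linarith
  have hdsum : ∀ x ∈ P, ∑ i ∈ Finset.range N, d (2 * i) x ≤ Δ := by
    intro x hx
    have h1 : ∑ i ∈ Finset.range (2 * N), d i x ≤ Δ := by
      have := hsum x hx
      rw [inner_sum] at this
      simp only [hd, Finset.sum_sub_distrib, Finset.sum_const, Finset.card_range, nsmul_eq_mul]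
      push_cast
      linarith
    refine le_trans ?_ h1
    rw [← Finset.sum_image (f := fun i => d i x) (g := fun i => 2 * i) (s := Finset.range N)]
    · refine Finset.sum_le_sum_of_subset_of_nonneg ?_ fun i _ _ => hd0 i x hx
      intro j hj
      simp only [Finset.mem_image, Finset.mem_range] at hj ⊢
      omega
    · intro a _ b _ h
      simpa using h
  obtain ⟨i, hi, hle⟩ : ∃ i ∈ Finset.range N, N * ∑ x ∈ P, d (2 * i) x ≤ P.card * Δ := by
    refine Finset.exists_le_of_sum_le (Finset.nonempty_range_iff.2 hN.ne') ?_
    rw [← Finset.mul_sum, Finset.sum_comm]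
    simp only [Finset.sum_const, Finset.card_range, nsmul_eq_mul]
    gcongr
    calc ∑ x ∈ P, ∑ i ∈ Finset.range N, d (2 * i) x ≤ ∑ x ∈ P, Δ := Finset.sum_le_sum hdsum
      _ = P.card * Δ := by simp
  refine ⟨i, Finset.mem_range.1 hi, ?_⟩
  refine le_trans ?_ hle
  rw [mul_left_comm]
  gcongr
  rw [← nsmul_eq_mul]
  refine le_trans ?_ (Finset.sum_le_sum_of_subset_of_nonneg
    (Finset.filter_subset (fun x => 2 * B * ε < ‖w (2 * i) x - B • u‖ ^ 2) P)
    fun x hx _ => hd0 _ x hx)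
  refine Finset.card_nsmul_le_sum _ _ _ fun x hx => ?_
  obtain ⟨hxP, hlt⟩ := Finset.mem_filter.1 hx
  have hB : 0 ≤ B := (norm_nonneg _).trans (hw (2 * i) x hxP)
  have hexp : ‖w (2 * i) x - B • u‖ ^ 2 ≤ 2 * B * d (2 * i) x := by
    rw [norm_sub_sq_real, inner_smul_right, norm_smul, hu, real_inner_comm, Real.norm_of_nonneg hB]
    have := hw (2 * i) x hxP
    have h2 : ‖w (2 * i) x‖ ^ 2 ≤ B ^ 2 := by gcongr
    simp only [hd]
    nlinarith
  by_contra hcon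
  push Not at hcon
  have : 2 * B * d (2 * i) x ≤ 2 * B * ε := by gcongr
  linarith

/-! ### Lattice points and the net -/

/-- The point `(m, n)` of the integer lattice. -/
noncomputable def latticePoint (m n : ℤ) : EuclideanSpace ℝ (Fin 2) := !₂[(m : ℝ), (n : ℝ)]

lemma norm_latticePoint_sub_le (m n m' n' : ℤ) :
    ‖latticePoint m n - latticePoint m' n'‖ ≤ |(m : ℝ) - m'| + |(n : ℝ) - n'| := by
  rw [EuclideanSpace.norm_eq, Fin.sum_univ_two]
  refine Real.sqrt_le_iff.2 ⟨by positivity, ?_⟩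
  simp only [latticePoint, PiLp.sub_apply, Real.norm_eq_abs]
  simp
  nlinarith [abs_nonneg ((m : ℝ) - m'), abs_nonneg ((n : ℝ) - n'), sq_abs ((m : ℝ) - m'),
    sq_abs ((n : ℝ) - n')]

lemma abs_fst_sub_le_norm (m n m' n' : ℤ) :
    |(m : ℝ) - m'| ≤ ‖latticePoint m n - latticePoint m' n'‖ := by
  simpa [latticePoint] using PiLp.norm_apply_le (latticePoint m n - latticePoint m' n') 0

lemma abs_snd_sub_le_norm (m n m' n' : ℤ) :
    |(n : ℝ) - n'| ≤ ‖latticePoint m n - latticePoint m' n'‖ := by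
  simpa [latticePoint] using PiLp.norm_apply_le (latticePoint m n - latticePoint m' n') 1

lemma exists_norm_sub_latticePoint_le (v : EuclideanSpace ℝ (Fin 2)) :
    ∃ i j : ℤ, ‖v - latticePoint i j‖ ≤ 2 := by
  refine ⟨⌊v 0⌋, ⌊v 1⌋, ?_⟩
  rw [EuclideanSpace.norm_eq, Fin.sum_univ_two]
  refine Real.sqrt_le_iff.2 ⟨by norm_num, ?_⟩
  have h0 := Int.floor_le (v 0)
  have h0' := Int.lt_floor_add_one (v 0)
  have h1 := Int.floor_le (v 1)
  have h1' := Int.lt_floor_add_one (v 1)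
  simp only [latticePoint, PiLp.sub_apply, Real.norm_eq_abs, sq_abs]
  simp only [Matrix.cons_val_zero, Matrix.cons_val_one]
  nlinarith

/-- The lattice points `(m, n)` kept in the net: the even columns, together with the odd columns in
every other interval of length `r n` of the row `n`. -/
def Kept (r : ℤ → ℕ) (m n : ℤ) : Prop := Even m ∨ Odd (m / (r n : ℤ))

/-- The net of all kept lattice points. -/
def rowNet (r : ℤ → ℕ) : Set (EuclideanSpace ℝ (Fin 2)) :=
  {x | ∃ m n : ℤ, Kept r m n ∧ x = latticePoint m n}

/-- The even columns alone are coarsely dense, so `r` is arbitrary. If `r n = 0`, division by zero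
gives 0 and only even columns survive. -/
lemma isSeparatedNet_rowNet (r : ℤ → ℕ) : IsSeparatedNet (rowNet r) := by
  refine ⟨1 / 2, 4, by norm_num, by norm_num, ?_, ?_⟩
  · rintro _ ⟨m, n, -, rfl⟩ _ ⟨m', n', -, rfl⟩ hne
    rw [dist_eq_norm]
    by_cases hm : m = m'
    · have hn : n ≠ n' := by
        rintro rfl
        exact hne (by rw [hm])
      have h1 : (1 : ℝ) ≤ |(n : ℝ) - n'| := by
        exact_mod_cast Int.one_le_abs (sub_ne_zero.2 hn)
      linarith [abs_snd_sub_le_norm m n m' n']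
    · have h1 : (1 : ℝ) ≤ |(m : ℝ) - m'| := by
        exact_mod_cast Int.one_le_abs (sub_ne_zero.2 hm)
      linarith [abs_fst_sub_le_norm m n m' n']
  · intro z
    obtain ⟨i, j, hij⟩ := exists_norm_sub_latticePoint_le z
    refine ⟨latticePoint (2 * (i / 2)) j, ⟨_, _, Or.inl (even_two_mul _), rfl⟩, ?_⟩
    have h1 := norm_latticePoint_sub_le i j (2 * (i / 2)) j
    have h2 : |(i : ℝ) - ((2 * (i / 2) : ℤ) : ℝ)| ≤ 1 := by
      have : |i - 2 * (i / 2)| ≤ 1 := by rw [abs_le]; omega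
      exact_mod_cast this
    rw [dist_eq_norm]
    have h3 := norm_add_le (z - latticePoint i j) (latticePoint i j - latticePoint (2 * (i / 2)) j)
    rw [sub_add_sub_cancel] at h3
    simp only [sub_self, abs_zero, add_zero] at h1
    linarith

/-! ### BiLipschitz bijections in coordinates -/

/-- The biLipschitz bijections from `rowNet r` to the integer lattice, in coordinates. -/
structure IsLatticeParam (r : ℤ → ℕ) (K : ℝ) (G : ℤ → ℤ → EuclideanSpace ℝ (Fin 2)) : Prop where
  one_le : 1 ≤ K
  norm_sub_le : ∀ {m n m' n' : ℤ}, Kept r m n → Kept r m' n' →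
    ‖G m n - G m' n'‖ ≤ K * (|(m : ℝ) - m'| + |(n : ℝ) - n'|)
  abs_fst_le : ∀ {m n m' n' : ℤ}, Kept r m n → Kept r m' n' →
    |(m : ℝ) - m'| ≤ K * ‖G m n - G m' n'‖
  abs_snd_le : ∀ {m n m' n' : ℤ}, Kept r m n → Kept r m' n' →
    |(n : ℝ) - n'| ≤ K * ‖G m n - G m' n'‖
  mem_lattice : ∀ {m n : ℤ}, Kept r m n → ∃ i j : ℤ, G m n = latticePoint i j
  surj : ∀ i j : ℤ, ∃ m n : ℤ, Kept r m n ∧ G m n = latticePoint i j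

lemma exists_isLatticeParam {r : ℤ → ℕ}
    (h : BiLipschitzEquivalent (rowNet r) integerLattice) : ∃ K G, IsLatticeParam r K G := by
  classical
  obtain ⟨f, K, hf, hf'⟩ := h
  set G : ℤ → ℤ → EuclideanSpace ℝ (Fin 2) := fun m n =>
    if hmn : latticePoint m n ∈ rowNet r then f ⟨_, hmn⟩ else 0 with hG
  have hmem : ∀ {m n}, Kept r m n → latticePoint m n ∈ rowNet r := fun hk => ⟨_, _, hk, rfl⟩
  have hGk : ∀ {m n} (hk : Kept r m n), G m n = f ⟨_, hmem hk⟩ := fun hk => dif_pos (hmem hk)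
  have hle : (K : ℝ) ≤ max K 1 := le_max_left _ _
  have hanti : ∀ {m n m' n'}, Kept r m n → Kept r m' n' →
      ‖latticePoint m n - latticePoint m' n'‖ ≤ max (K : ℝ) 1 * ‖G m n - G m' n'‖ := by
    intro m n m' n' hk hk'
    have := hf'.le_mul_dist ⟨_, hmem hk⟩ ⟨_, hmem hk'⟩
    rw [hGk hk, hGk hk', ← dist_eq_norm, ← dist_eq_norm]
    exact this.trans (mul_le_mul_of_nonneg_right hle dist_nonneg)
  refine ⟨max K 1, G, le_max_right _ _, ?_, ?_, ?_, ?_, ?_⟩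
  · intro m n m' n' hk hk'
    have := hf.dist_le_mul ⟨_, hmem hk⟩ ⟨_, hmem hk'⟩
    rw [Subtype.dist_eq, Subtype.dist_eq, dist_eq_norm, dist_eq_norm] at this
    rw [hGk hk, hGk hk']
    exact this.trans (mul_le_mul hle (norm_latticePoint_sub_le _ _ _ _) (norm_nonneg _)
      (zero_le_one.trans (le_max_right _ _)))
  · exact fun hk hk' => (abs_fst_sub_le_norm _ _ _ _).trans (hanti hk hk')
  · exact fun hk hk' => (abs_snd_sub_le_norm _ _ _ _).trans (hanti hk hk')
  · intro m n hk
    obtain ⟨i, hi⟩ := (f ⟨_, hmem hk⟩).2 0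
    obtain ⟨j, hj⟩ := (f ⟨_, hmem hk⟩).2 1
    refine ⟨i, j, ?_⟩
    rw [hGk hk]
    ext t
    fin_cases t
    · simpa [latticePoint] using hi
    · simpa [latticePoint] using hj
  · intro i j
    have hij : latticePoint i j ∈ integerLattice := by
      intro t
      fin_cases t
      · exact ⟨i, by simp [latticePoint]⟩
      · exact ⟨j, by simp [latticePoint]⟩
    obtain ⟨⟨x, hx⟩, hfx⟩ := f.surjective ⟨_, hij⟩
    obtain ⟨m, n, hk, rfl⟩ := id hx
    exact ⟨m, n, hk, by rw [hGk hk, hfx]⟩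

lemma Kept.of_even {r : ℤ → ℕ} {m : ℤ} (hm : Even m) (n : ℤ) : Kept r m n := Or.inl hm

lemma kept_dense {r : ℤ → ℕ} {s t : ℕ} (ht : t < s) (q : ℤ) {n : ℤ} (hn : r n = s) :
    Kept r (2 * s * q + s + t) n := by
  right
  rw [hn, show 2 * (s : ℤ) * q + s + t = t + s * (2 * q + 1) by ring,
    Int.add_mul_ediv_left _ _ (by omega), Int.ediv_eq_zero_of_lt (by omega) (by omega), zero_add]
  exact odd_two_mul_add_one q

lemma Kept.even_of_sparse {r : ℤ → ℕ} {s : ℕ} {q m n : ℤ} (hk : Kept r m n) (hn : r n = s)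
    (h1 : 2 * s * q ≤ m) (h2 : m < 2 * s * q + s) : Even m := by
  rcases hk with hk | hk
  · exact hk
  · exfalso
    have : m / (s : ℤ) = 2 * q := by
      obtain ⟨t, rfl⟩ : ∃ t, m = t + s * (2 * q) := ⟨m - s * (2 * q), by ring⟩
      rw [Int.add_mul_ediv_left _ _ (by nlinarith),
        Int.ediv_eq_zero_of_lt (by linarith) (by linarith), zero_add]
    rw [hn, this] at hk
    exact Int.not_odd_iff_even.2 (even_two_mul q) hk

/-! ### Counting in sparse and dense squares -/

/-- Few kept points lie near a sparse square. -/
lemma card_kept_near_sparse_le {r : ℤ → ℕ} {h s R : ℕ} (hs : s = 2 * h) (q y : ℤ)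
    (hrows : ((Finset.range s).filter fun b : ℕ => r (y + b) ≠ s).card * 16 ≤ s)
    (hR : 32 * R ≤ s) (A : Finset (ℤ × ℤ))
    (hA : ∀ p ∈ A, Kept r p.1 p.2 ∧ 2 * s * q - R ≤ p.1 ∧ p.1 < 2 * s * q + s + R ∧
      y - R ≤ p.2 ∧ p.2 < y + s + R) :
    16 * A.card ≤ 12 * (s * s) := by
  classical
  set bad := (Finset.range s).filter fun b : ℕ => r (y + b) ≠ s
  set big := Finset.Ico (2 * s * q - R : ℤ) (2 * s * q + s + R) ×ˢ
    Finset.Ico (y - R : ℤ) (y + s + R)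
  set small := Finset.Ico (2 * s * q : ℤ) (2 * s * q + s) ×ˢ Finset.Ico (y : ℤ) (y + s)
  set ev := (Finset.range h ×ˢ Finset.range s).image
    fun p : ℕ × ℕ => ((2 * s * q + 2 * p.1 : ℤ), (y + p.2 : ℤ))
  set br := (Finset.range s ×ˢ bad).image
    fun p : ℕ × ℕ => ((2 * s * q + p.1 : ℤ), (y + p.2 : ℤ))
  -- Inside the square a kept point has an even column or lies in a bad row; otherwise it lies in
  -- the collar of width R.
  have hsub : A ⊆ (ev ∪ br) ∪ (big \ small) := by
    rintro ⟨m, n⟩ hp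
    obtain ⟨hk, h1, h2, h3, h4⟩ := hA _ hp
    simp only at hk h1 h2 h3 h4
    by_cases hsm : (m, n) ∈ small
    · refine Finset.mem_union_left _ ?_
      simp only [small, Finset.mem_product, Finset.mem_Ico] at hsm
      obtain ⟨⟨h5, h6⟩, h7, h8⟩ := hsm
      obtain ⟨b, hb⟩ := Int.eq_ofNat_of_zero_le (sub_nonneg.2 h7)
      obtain ⟨t, ht⟩ := Int.eq_ofNat_of_zero_le (sub_nonneg.2 h5)
      have hn : n = y + b := by omega
      by_cases hr : r n = s
      · refine Finset.mem_union_left _ ?_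
        obtain ⟨c, hc⟩ := hk.even_of_sparse hr h5 h6
        have htc : (t : ℤ) = 2 * (c - s * q) := by rw [← ht, hc]; ring
        refine Finset.mem_image.2 ⟨(t / 2, b), ?_, ?_⟩
        · simp only [Finset.mem_product, Finset.mem_range]
          omega
        · ext
          · have : ((t / 2 : ℕ) : ℤ) * 2 = t := by omega
            simp only
            linarith
          · exact hn.symm
      · refine Finset.mem_union_right _ (Finset.mem_image.2 ⟨(t, b), ?_, ?_⟩)
        · simp only [bad, Finset.mem_product, Finset.mem_range, Finset.mem_filter]
          rw [← hn]
          exact ⟨by omega, by omega, hr⟩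
        · ext
          · simp only
            linarith
          · exact hn.symm
    · refine Finset.mem_union_right _ (Finset.mem_sdiff.2 ⟨?_, hsm⟩)
      simp only [big, Finset.mem_product, Finset.mem_Ico]
      exact ⟨⟨h1, h2⟩, h3, h4⟩
  have hev : ev.card ≤ h * s := Finset.card_image_le.trans (by simp)
  have hbr : br.card ≤ s * bad.card := Finset.card_image_le.trans (by simp)
  have hss : small ⊆ big := by
    rintro ⟨m, n⟩ hp
    simp only [small, big, Finset.mem_product, Finset.mem_Ico] at hp ⊢
    omega
  have hbig : big.card = (s + 2 * R) * (s + 2 * R) := by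
    simp only [big, Finset.card_product, Int.card_Ico]
    congr 1 <;> omega
  have hsmall : small.card = s * s := by
    simp only [small, Finset.card_product, Int.card_Ico]
    congr 1 <;> omega
  have hdiff : (big \ small).card + s * s = (s + 2 * R) * (s + 2 * R) := by
    rw [← hbig, ← hsmall]
    exact Finset.card_sdiff_add_card_eq_card hss
  have h1 := Finset.card_le_card hsub
  have h2 := Finset.card_union_le (ev ∪ br) (big \ small)
  have h3 := Finset.card_union_le ev br
  -- In units of s²: 1/2 for even columns, 1/16 for bad rows, and 1/8 + 1/256 for the collar, in
  -- total below 12/16.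
  have h4 : s * bad.card * 16 ≤ s * s := by rw [mul_assoc]; gcongr
  have h5 : 2 * (h * s) = s * s := by rw [hs]; ring
  have h6 : 32 * (R * s) ≤ s * s := by rw [← mul_assoc]; gcongr
  have h7 : 32 * (R * R) ≤ s * R := by rw [← mul_assoc]; gcongr
  nlinarith

/-- Most points of a dense square lie in good rows and above good base points. -/
lemma le_card_dense {r : ℤ → ℕ} {h s : ℕ} (hs : s = 2 * h) (y : ℤ) (Q : ℕ × ℕ → Prop)
    [DecidablePred Q]
    (hrows : ((Finset.range s).filter fun b : ℕ => r (y + b) ≠ s).card * 16 ≤ s)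
    (hQ : ((Finset.range h ×ˢ Finset.range s).filter fun p => ¬ Q p).card * 16 ≤ h * s) :
    14 * (s * s) ≤ 16 * ((Finset.range s ×ˢ Finset.range s).filter
      fun p : ℕ × ℕ => r (y + p.2) = s ∧ Q (p.1 / 2, p.2)).card := by
  classical
  set bad := (Finset.range s).filter fun b : ℕ => r (y + b) ≠ s
  set badp := (Finset.range h ×ˢ Finset.range s).filter fun p => ¬ Q p
  set good := (Finset.range s ×ˢ Finset.range s).filter
      fun p : ℕ × ℕ => r (y + p.2) = s ∧ Q (p.1 / 2, p.2)
  -- Each bad base point spoils two columns, so bad rows and bad base points cost s²/16 each.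
  have hsub : Finset.range s ×ˢ Finset.range s ⊆ (good ∪ Finset.range s ×ˢ bad) ∪
      (badp ×ˢ Finset.range 2).image fun p : (ℕ × ℕ) × ℕ => (2 * p.1.1 + p.2, p.1.2) := by
    rintro ⟨t, b⟩ hp
    simp only [Finset.mem_product, Finset.mem_range] at hp
    by_cases hr : r (y + b) = s
    · by_cases hq : Q (t / 2, b)
      · refine Finset.mem_union_left _ (Finset.mem_union_left _ ?_)
        simp only [good, Finset.mem_filter, Finset.mem_product, Finset.mem_range]
        exact ⟨hp, hr, hq⟩
      · refine Finset.mem_union_right _ (Finset.mem_image.2 ⟨((t / 2, b), t % 2), ?_, ?_⟩)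
        · simp only [badp, Finset.mem_product, Finset.mem_range, Finset.mem_filter]
          exact ⟨⟨by omega, hq⟩, by omega⟩
        · simp only [Prod.mk.injEq, and_true]
          omega
    · refine Finset.mem_union_left _ (Finset.mem_union_right _ ?_)
      simp only [bad, Finset.mem_product, Finset.mem_range, Finset.mem_filter]
      exact ⟨hp.1, hp.2, hr⟩
  have h1 := Finset.card_le_card hsub
  have h2 := (Finset.card_union_le _ _).trans
    (add_le_add (Finset.card_union_le good (Finset.range s ×ˢ bad))
      (Finset.card_image_le (s := badp ×ˢ Finset.range 2)
        (f := fun p : (ℕ × ℕ) × ℕ => (2 * p.1.1 + p.2, p.1.2))))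
  simp only [Finset.card_product, Finset.card_range] at h1 h2
  have h4 : s * bad.card * 16 ≤ s * s := by rw [mul_assoc]; gcongr
  have h5 : 2 * (h * s) = s * s := by rw [hs]; ring
  omega

/-- A dense square cannot be carried close to a translate of the image of the adjacent sparse
square. -/
lemma IsLatticeParam.false_of_translated_square {r : ℤ → ℕ} {K : ℝ}
    {G : ℤ → ℤ → EuclideanSpace ℝ (Fin 2)} (hG : IsLatticeParam r K G) {h s : ℕ} (hs : s = 2 * h)
    (hKs : 64 * K * (K + 2) ≤ s) (q y : ℤ) (V : EuclideanSpace ℝ (Fin 2))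
    (hrows : ((Finset.range s).filter fun b : ℕ => r (y + b) ≠ s).card * 16 ≤ s)
    (hbad : ((Finset.range h ×ˢ Finset.range s).filter fun p : ℕ × ℕ =>
      ¬ ‖G (2 * s * q + s + 2 * p.1) (y + p.2) - G (2 * s * q + 2 * p.1) (y + p.2) - V‖
        ≤ s / (64 * K)).card * 16 ≤ h * s) : False := by
  classical
  have hK := hG.one_le
  have hs0 : 0 < s := by
    have : (0 : ℝ) < s := lt_of_lt_of_le (by positivity) hKs
    exact_mod_cast this
  have hse : Even (s : ℤ) := ⟨h, by omega⟩
  set Q : ℕ × ℕ → Prop := fun p =>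
    ‖G (2 * s * q + s + 2 * p.1) (y + p.2) - G (2 * s * q + 2 * p.1) (y + p.2) - V‖
        ≤ s / (64 * K) with hQ
  have hcard := le_card_dense hs y Q hrows hbad
  set good := (Finset.range s ×ˢ Finset.range s).filter
      fun p : ℕ × ℕ => r (y + p.2) = s ∧ Q (p.1 / 2, p.2) with hgood
  obtain ⟨i, j, hij⟩ := exists_norm_sub_latticePoint_le V
  have hsub : ∀ a b c d : ℤ,
      latticePoint a b - latticePoint c d = latticePoint (a - c) (b - d) := by
    intro a b c d
    ext t
    fin_cases t <;> simp [latticePoint]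
  have hkept : ∀ p ∈ good, Kept r (2 * s * q + s + p.1) (y + p.2) := by
    intro p hp
    simp only [hgood, Finset.mem_filter, Finset.mem_product, Finset.mem_range] at hp
    exact kept_dense hp.1.1 q hp.2.1
  -- Surjectivity enters here: the image of a dense point, shifted by the lattice vector nearest in
  -- effect to V, is again the image of a net point.
  have hex : ∀ p : ℕ × ℕ, ∃ z : ℤ × ℤ, p ∈ good → Kept r z.1 z.2 ∧
      G z.1 z.2 = G (2 * s * q + s + p.1) (y + p.2) - latticePoint i j := by
    intro p
    by_cases hp : p ∈ good
    · obtain ⟨a, b, hab⟩ := hG.mem_lattice (hkept p hp)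
      obtain ⟨m, n, hk, hmn⟩ := hG.surj (a - i) (b - j)
      exact ⟨(m, n), fun _ => ⟨hk, by rw [hab, hsub, hmn]⟩⟩
    · exact ⟨0, fun h => absurd h hp⟩
  choose z hz using hex
  have hinj : Set.InjOn z good := by
    intro p hp p' hp' hzz
    have h1 := (hz p hp).2
    rw [hzz, (hz p' hp').2, sub_left_inj] at h1
    have h2 := hG.abs_fst_le (hkept p hp) (hkept p' hp')
    have h3 := hG.abs_snd_le (hkept p hp) (hkept p' hp')
    rw [h1, sub_self, norm_zero, mul_zero] at h2 h3
    have h2' := abs_nonpos_iff.1 h2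
    have h3' := abs_nonpos_iff.1 h3
    push_cast at h2' h3'
    ext
    · have : (p.1 : ℝ) = p'.1 := by linarith
      exact_mod_cast this
    · have : (p.2 : ℝ) = p'.2 := by linarith
      exact_mod_cast this
  -- The errors come from rounding to an even column (K), rounding V (2) and the hypothesis on V.
  have hnear : ∀ p ∈ good, ‖G (z p).1 (z p).2 -
      G (2 * s * q + 2 * (p.1 / 2 : ℕ)) (y + p.2)‖ ≤ K + 2 + s / (64 * K) := by
    intro p hp
    have hpm := hp
    simp only [hgood, Finset.mem_filter, Finset.mem_product, Finset.mem_range] at hpm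
    have h1 : ‖G (2 * s * q + s + 2 * (p.1 / 2 : ℕ)) (y + p.2) -
      G (2 * s * q + 2 * (p.1 / 2 : ℕ)) (y + p.2) - V‖ ≤ s / (64 * K) := hpm.2.2
    have hev : Even (2 * s * q + s + 2 * ((p.1 / 2 : ℕ) : ℤ)) :=
      (((even_two_mul _).mul_right _).add hse).add (even_two_mul _)
    have h2 := hG.norm_sub_le (hkept p hp) (Kept.of_even hev (y + p.2))
    have h3 : |((2 * s * q + s + p.1 : ℤ) : ℝ) - ((2 * s * q + s + 2 * (p.1 / 2 : ℕ) : ℤ) : ℝ)|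
        ≤ 1 := by
      have : |(2 * s * q + s + p.1 : ℤ) - (2 * s * q + s + 2 * (p.1 / 2 : ℕ) : ℤ)| ≤ 1 := by
        rw [add_sub_add_left_eq_sub, abs_le]; omega
      exact_mod_cast this
    rw [sub_self, abs_zero, add_zero] at h2
    have h4 : K * |((2 * s * q + s + p.1 : ℤ) : ℝ) -
        ((2 * s * q + s + 2 * (p.1 / 2 : ℕ) : ℤ) : ℝ)| ≤ K * 1 := by gcongr
    rw [(hz p hp).2]
    calc _ = ‖(G (2 * s * q + s + p.1) (y + p.2) -
            G (2 * s * q + s + 2 * (p.1 / 2 : ℕ)) (y + p.2)) + (V - latticePoint i j) +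
          (G (2 * s * q + s + 2 * (p.1 / 2 : ℕ)) (y + p.2) -
            G (2 * s * q + 2 * (p.1 / 2 : ℕ)) (y + p.2) - V)‖ := by congr 1; abel
      _ ≤ _ := (norm_add₃_le).trans (by linarith)
  have hR : K * (K + 2 + s / (64 * K)) ≤ s / 32 := by
    have : K * (s / (64 * K)) = s / 64 := by field_simp
    rw [mul_add, this]
    linarith
  have hdist : ∀ a b : ℤ, |(a : ℝ) - b| ≤ s / 32 → |a - b| ≤ (s / 32 : ℕ) := by
    intro a b hab
    have h1 : |(a : ℝ) - b| * 32 ≤ s := by linarith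
    have h2 : |a - b| * 32 ≤ s := by exact_mod_cast h1
    omega
  have hA := card_kept_near_sparse_le (R := s / 32) hs q y hrows (by omega) (good.image z) (by
    intro w hw
    obtain ⟨p, hp, rfl⟩ := Finset.mem_image.1 hw
    have hpm := hp
    simp only [hgood, Finset.mem_filter, Finset.mem_product, Finset.mem_range] at hpm
    have hev : Even (2 * s * q + 2 * ((p.1 / 2 : ℕ) : ℤ)) :=
      ((even_two_mul _).mul_right _).add (even_two_mul _)
    have hd : K * ‖G (z p).1 (z p).2 - G (2 * s * q + 2 * (p.1 / 2 : ℕ)) (y + p.2)‖ ≤ s / 32 :=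
      le_trans (by gcongr; exact hnear p hp) hR
    have h1 := hdist _ _ ((hG.abs_fst_le (hz p hp).1 (Kept.of_even hev (y + p.2))).trans hd)
    have h2 := hdist _ _ ((hG.abs_snd_le (hz p hp).1 (Kept.of_even hev (y + p.2))).trans hd)
    rw [abs_le] at h1 h2
    refine ⟨(hz p hp).1, ?_, ?_, ?_, ?_⟩ <;> omega)
  rw [Finset.card_image_of_injOn hinj] at hA
  have : 0 < s * s := by positivity
  omega

/-! ### Stretching at a smaller scale -/

/-- A pair stretched by a factor `A`, at distance `2 * N * s` along a row, forces a pair stretched by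
a definitely larger factor at distance `s` in any nearby strip of rows mostly of period `s`. -/
lemma IsLatticeParam.exists_more_stretched {r : ℤ → ℕ} {K : ℝ}
    {G : ℤ → ℤ → EuclideanSpace ℝ (Fin 2)} (hG : IsLatticeParam r K G) {h s N : ℕ}
    (hs : s = 2 * h) (hKs : 64 * K * (K + 2) ≤ s) (hN : 0 < N) {κ A D : ℝ}
    (hκ : κ = 1 / (2 ^ 20 * K ^ 4)) (hA : 0 < A) {m₀ n₀ y : ℤ} (hm₀ : Even m₀)
    (hstretch : A * (2 * N * s) ≤ ‖G (m₀ + 2 * N * s) n₀ - G m₀ n₀‖)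
    (hD : ∀ b : ℕ, b < s → 2 * s + |((y + b : ℤ) : ℝ) - n₀| ≤ D) (hDN : D ≤ κ * (N * s))
    (hrows : ((Finset.range s).filter fun b : ℕ => r (y + b) ≠ s).card * 16 ≤ s) :
    ∃ m n : ℤ, Even m ∧ y ≤ n ∧ n < y + s ∧ (1 + κ) * A * s ≤ ‖G (m + s) n - G m n‖ := by
  classical
  by_contra hcon
  push Not at hcon
  have hK := hG.one_le
  have hK0 : 0 < K := by linarith
  have hs0 : 0 < s := by
    have : (0 : ℝ) < s := lt_of_lt_of_le (by positivity) hKs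
    exact_mod_cast this
  have hsR : (0 : ℝ) < s := by exact_mod_cast hs0
  have hNR : (0 : ℝ) < N := by exact_mod_cast hN
  have hse : Even (s : ℤ) := ⟨h, by omega⟩
  have hκ0 : 0 < κ := by rw [hκ]; positivity
  have hκ1 : κ ≤ 1 := by
    rw [hκ, div_le_one (by positivity)]
    nlinarith [one_le_pow₀ hK (n := 4)]
  have hTe : Even (2 * N * s : ℤ) := (even_two_mul _).mul_right _
  have hAK : A ≤ K := by
    have h1 := hG.norm_sub_le (Kept.of_even (hm₀.add hTe) n₀) (Kept.of_even hm₀ n₀)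
    have h2 : ((m₀ + 2 * N * s : ℤ) : ℝ) - m₀ = 2 * N * s := by push_cast; ring
    rw [h2, sub_self, abs_zero, add_zero, abs_of_nonneg (by positivity)] at h1
    exact le_of_mul_le_mul_right (hstretch.trans h1) (by positivity)
  set v := G (m₀ + 2 * N * s) n₀ - G m₀ n₀ with hv
  have hv0 : 0 < ‖v‖ := lt_of_lt_of_le (by positivity) hstretch
  set u := ‖v‖⁻¹ • v with hu
  have hu1 : ‖u‖ = 1 := by
    rw [hu, norm_smul, norm_inv, norm_norm, inv_mul_cancel₀ hv0.ne']
  have huv : inner ℝ u v = ‖v‖ := by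
    rw [hu, real_inner_smul_left, real_inner_self_eq_norm_sq]
    field_simp
  -- Starting points are aligned with the period 2s, so that even-indexed steps lead from sparse to
  -- dense intervals.
  set c := m₀ / (2 * s) with hc
  have hc1 : 2 * s * c ≤ m₀ := Int.mul_ediv_self_le (by omega)
  have hc2 : m₀ < 2 * s * c + 2 * s := Int.lt_mul_ediv_self_add (by omega)
  set f : ℕ × ℕ → ℕ → EuclideanSpace ℝ (Fin 2) :=
    fun p i => G (2 * s * c + 2 * p.1 + i * s) (y + p.2) with hf
  have heven : ∀ (a i : ℕ), Even (2 * s * c + 2 * a + i * s : ℤ) := fun a i =>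
    (((even_two_mul _).mul_right _).add (even_two_mul _)).add (hse.mul_left _)
  have hclose : ∀ p ∈ Finset.range h ×ˢ Finset.range s,
      |((2 * s * c + 2 * p.1 : ℤ) : ℝ) - m₀| + |((y + p.2 : ℤ) : ℝ) - n₀| ≤ D := by
    intro p hp
    simp only [Finset.mem_product, Finset.mem_range] at hp
    have h1 : |(2 * s * c + 2 * p.1 : ℤ) - m₀| ≤ 2 * s := by rw [abs_le]; omega
    have h2 : |((2 * s * c + 2 * p.1 : ℤ) : ℝ) - m₀| ≤ 2 * s := by exact_mod_cast h1
    linarith [hD p.2 hp.2]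
  -- Δ is the loss from replacing A by (1 + κ)A, plus an error K * D at each end; ε makes the bad
  -- fraction Δ / (N * ε) at most 1/16.
  obtain ⟨i, -, hi⟩ := exists_even_index_near (Finset.range h ×ˢ Finset.range s)
    (fun i p => f p (i + 1) - f p i) u hu1 (B := (1 + κ) * A * s)
    (Δ := κ * A * (2 * N * s) + 2 * K * D) (ε := 64 * K * κ * s) hN (by
      intro i p hp
      simp only [Finset.mem_product, Finset.mem_range] at hp
      have := hcon (2 * s * c + 2 * p.1 + i * s) (y + p.2) (heven _ _) (by omega) (by omega)
      refine le_trans (le_of_eq ?_) this.le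
      simp only [hf]
      congr 3
      push_cast
      ring) (by
      intro p hp
      rw [Finset.sum_range_sub (f p)]
      have hd := hclose p hp
      have e1 : ‖f p (2 * N) - G (m₀ + 2 * N * s) n₀‖ ≤ K * D := by
        refine (hG.norm_sub_le (Kept.of_even (heven _ _) _)
          (Kept.of_even (hm₀.add hTe) n₀)).trans ?_
        gcongr
        refine le_trans (le_of_eq ?_) hd
        congr 2
        push_cast
        ring
      have e2 : ‖G m₀ n₀ - f p 0‖ ≤ K * D := by
        rw [norm_sub_rev]
        refine (hG.norm_sub_le (Kept.of_even (heven _ _) _) (Kept.of_even hm₀ n₀)).trans ?_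
        gcongr
        refine le_trans (le_of_eq ?_) hd
        congr 2
        push_cast
        ring
      have hsplit : f p (2 * N) - f p 0 =
          v + (f p (2 * N) - G (m₀ + 2 * N * s) n₀) + (G m₀ n₀ - f p 0) := by
        rw [hv]; abel
      rw [hsplit, inner_add_right, inner_add_right, huv]
      have i1 := (abs_le.1 (abs_real_inner_le_norm u (f p (2 * N) - G (m₀ + 2 * N * s) n₀))).1
      have i2 := (abs_le.1 (abs_real_inner_le_norm u (G m₀ n₀ - f p 0))).1
      rw [hu1, one_mul] at i1 i2
      linarith)
  -- This identity dictates the value of κ: it turns the averaging threshold 2Bε into at most (s /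
  -- (64K))².
  have hKκ : 2 * (2 * K) * (64 * K * κ) = (1 / (64 * K)) ^ 2 := by
    rw [hκ]; field_simp; norm_num
  refine hG.false_of_translated_square hs hKs (c + i) y (((1 + κ) * A * s) • u) hrows ?_
  have hle : ∀ n : ℕ, (n : ℝ) * (N * (64 * K * κ * s)) ≤ (h * s : ℕ) *
      (κ * A * (2 * N * s) + 2 * K * D) → n * 16 ≤ h * s := by
    intro n hn
    have h1 : κ * A * (2 * N * s) + 2 * K * D ≤ 4 * K * κ * (N * s) := by
      have h2 : κ * A * (2 * N * s) ≤ κ * K * (2 * N * s) := by gcongr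
      have h3 : 2 * K * D ≤ 2 * K * (κ * (N * s)) := by gcongr
      linarith
    have h4 : (n : ℝ) * (N * (64 * K * κ * s)) ≤ (h * s : ℕ) * (4 * K * κ * (N * s)) :=
      hn.trans (by gcongr)
    have h5 : ((n : ℝ) * 16) * (4 * K * κ * (N * s)) ≤ (h * s : ℕ) * (4 * K * κ * (N * s)) := by
      linarith
    have h6 := le_of_mul_le_mul_right h5 (by positivity)
    exact_mod_cast h6
  refine le_trans (Nat.mul_le_mul_right _ (Finset.card_le_card ?_)) (hle _ (by simpa using hi))
  intro p hp
  simp only [Finset.mem_filter] at hp ⊢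
  refine ⟨hp.1, ?_⟩
  have hp2 := not_le.1 hp.2
  have e : f p (2 * i + 1) - f p (2 * i) = G (2 * s * (c + i) + s + 2 * p.1) (y + p.2) -
      G (2 * s * (c + i) + 2 * p.1) (y + p.2) := by
    simp only [hf]
    congr 2 <;> push_cast <;> ring
  rw [e]
  have hsq : (s / (64 * K)) ^ 2 < ‖G (2 * s * (c + i) + s + 2 * p.1) (y + p.2) -
      G (2 * s * (c + i) + 2 * p.1) (y + p.2) - ((1 + κ) * A * s) • u‖ ^ 2 := by gcongr
  refine lt_of_le_of_lt ?_ hsq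
  have h7 : (1 + κ) * A ≤ 2 * K := by
    calc (1 + κ) * A ≤ (1 + 1) * K := by gcongr
      _ = 2 * K := by ring
  calc 2 * ((1 + κ) * A * s) * (64 * K * κ * s) = 2 * ((1 + κ) * A) * (64 * K * κ) * s ^ 2 := by
        ring
    _ ≤ 2 * (2 * K) * (64 * K * κ) * s ^ 2 := by gcongr
    _ = (s / (64 * K)) ^ 2 := by rw [hKκ]; ring

/-! ### Row periods carrying many scales -/

/-- The row period at height `n`: the power of `M` at the first odd place where the base `M` digit
of `n` vanishes. -/
noncomputable def digitPeriod (M n : ℕ) : ℕ :=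
  M ^ (2 * sInf {j | n % M ^ (2 * j + 2) < M ^ (2 * j + 1)} + 1)

/-- In these rows the digit at place 2j + 1 vanishes, so the period can differ only if one of the j
earlier odd places also has digit 0, each in a fraction 1/M of the rows. -/
lemma card_digitPeriod_ne_mul_le (M j q : ℕ) :
    ((Finset.range (M ^ (2 * j + 1))).filter fun b =>
      digitPeriod M (M ^ (2 * j + 2) * q + b) ≠ M ^ (2 * j + 1)).card * M
      ≤ j * M ^ (2 * j + 1) := by
  classical
  have hsub : ((Finset.range (M ^ (2 * j + 1))).filter fun b =>
      digitPeriod M (M ^ (2 * j + 2) * q + b) ≠ M ^ (2 * j + 1)) ⊆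
      (Finset.range j).biUnion fun i => (Finset.range (M ^ (2 * j + 1))).filter fun b =>
        b % M ^ (2 * i + 2) < M ^ (2 * i + 1) := by
    intro b hb
    simp only [Finset.mem_filter, Finset.mem_range, Finset.mem_biUnion] at hb ⊢
    obtain ⟨hbs, hne⟩ := hb
    have hmod : ∀ i ≤ j, (M ^ (2 * j + 2) * q + b) % M ^ (2 * i + 2) = b % M ^ (2 * i + 2) := by
      intro i hij
      obtain ⟨k, hk⟩ := pow_dvd_pow M (show 2 * i + 2 ≤ 2 * j + 2 by omega)
      rw [hk, mul_assoc, Nat.mul_add_mod]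
    set Z := {i | (M ^ (2 * j + 2) * q + b) % M ^ (2 * i + 2) < M ^ (2 * i + 1)} with hZ
    have hjZ : j ∈ Z := by
      simp only [hZ, Set.mem_ofPred_eq]
      rw [hmod j le_rfl]
      exact (Nat.mod_le _ _).trans_lt hbs
    have hlt : sInf Z < j := by
      refine lt_of_le_of_ne (Nat.sInf_le hjZ) fun heq => hne ?_
      rw [digitPeriod, ← hZ, heq]
    refine ⟨sInf Z, hlt, hbs, ?_⟩
    have := Nat.sInf_mem ⟨j, hjZ⟩
    simp only [hZ, Set.mem_ofPred_eq] at this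
    rwa [hmod _ hlt.le] at this
  have hone : ∀ i ∈ Finset.range j, ((Finset.range (M ^ (2 * j + 1))).filter fun b =>
        b % M ^ (2 * i + 2) < M ^ (2 * i + 1)).card ≤ M ^ (2 * j) := by
    intro i hi
    rw [Finset.mem_range] at hi
    obtain ⟨k, rfl⟩ : ∃ k, j = i + 1 + k := ⟨j - (i + 1), by omega⟩
    have hpow : M ^ (2 * (i + 1 + k) + 1) = M ^ (2 * i + 2) * M ^ (2 * k + 1) := by
      rw [← pow_add]; congr 1; ring
    have := Finset.card_le_card_of_injOn (s := (Finset.range (M ^ (2 * (i + 1 + k) + 1))).filter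
        fun b => b % M ^ (2 * i + 2) < M ^ (2 * i + 1))
      (t := Finset.range (M ^ (2 * i + 1)) ×ˢ Finset.range (M ^ (2 * k + 1)))
      (fun b => (b % M ^ (2 * i + 2), b / M ^ (2 * i + 2))) (by
        intro b hb
        simp only [Finset.coe_filter, Finset.mem_range, Set.mem_ofPred_eq] at hb
        simp only [Finset.coe_product, Finset.coe_range, Set.mem_prod, Set.mem_Iio]
        exact ⟨hb.2, Nat.div_lt_of_lt_mul (hpow ▸ hb.1)⟩) (by
        intro a _ b _ hab
        simp only [Prod.mk.injEq] at hab
        rw [← Nat.div_add_mod a (M ^ (2 * i + 2)), hab.1, hab.2, Nat.div_add_mod])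
    refine this.trans (le_of_eq ?_)
    rw [Finset.card_product, Finset.card_range, Finset.card_range, ← pow_add]
    congr 1; ring
  have h1 := (Finset.card_le_card hsub).trans (Finset.card_biUnion_le_card_mul _ _ _ hone)
  rw [Finset.card_range] at h1
  calc _ ≤ j * M ^ (2 * j) * M := Nat.mul_le_mul_right _ h1
    _ = j * M ^ (2 * j + 1) := by rw [pow_succ, mul_assoc]

/-- Finite words of any lengths all occur in a single bi-infinite word. -/
lemma exists_word_containing (p : ℕ → ℕ → ℕ) (W : ℕ → ℕ) :
    ∃ r : ℤ → ℕ, ∀ M, ∃ Y : ℤ, ∀ n < W M, r (Y + n) = p M n := by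
  classical
  -- The words are laid end to end, so their windows are disjoint.
  set Y : ℕ → ℕ := fun M => ∑ i ∈ Finset.range M, W i with hY
  have hmono : Monotone Y := fun a b hab =>
    Finset.sum_le_sum_of_subset (Finset.range_mono hab)
  have hsucc : ∀ M, Y (M + 1) = Y M + W M := fun M => Finset.sum_range_succ _ _
  have hinj : Function.Injective
      fun x : (M : ℕ) × Fin (W M) => ((Y x.1 : ℤ) + (x.2 : ℕ) : ℤ) := by
    rintro ⟨M, a⟩ ⟨M', b⟩ hab
    have hab' : Y M + (a : ℕ) = Y M' + (b : ℕ) := by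
      simp only at hab
      exact_mod_cast hab
    have ha := a.2
    have hb := b.2
    obtain hlt | rfl | hlt := lt_trichotomy M M'
    · have := hmono (Nat.succ_le_of_lt hlt)
      rw [Nat.succ_eq_add_one, hsucc] at this
      omega
    · have : a = b := Fin.ext (by omega)
      rw [this]
    · have := hmono (Nat.succ_le_of_lt hlt)
      rw [Nat.succ_eq_add_one, hsucc] at this
      omega
  refine ⟨Function.extend (fun x : (M : ℕ) × Fin (W M) => ((Y x.1 : ℤ) + (x.2 : ℕ) : ℤ))
    (fun x => p x.1 x.2) 0, fun M => ⟨Y M, fun n hn => ?_⟩⟩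
  exact hinj.extend_apply _ _ ⟨M, ⟨n, hn⟩⟩

/-! ### Descent through the scales -/

/-- No biLipschitz bijection onto the lattice exists if the digit periods of every base `M` occur in
long intervals of rows. -/
lemma IsLatticeParam.false_of_digitPeriod {r : ℤ → ℕ} {K : ℝ}
    {G : ℤ → ℤ → EuclideanSpace ℝ (Fin 2)} (hG : IsLatticeParam r K G)
    (hr : ∀ M : ℕ, ∃ Y : ℤ, ∀ n < M ^ (2 * M + 1), r (Y + n) = digitPeriod M n) : False := by
  have hK := hG.one_le
  have hK0 : 0 < K := by linarith
  obtain ⟨κ, hκ⟩ : ∃ κ, κ = 1 / (2 ^ 20 * K ^ 4) := ⟨_, rfl⟩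
  have hκ0 : 0 < κ := by rw [hκ]; positivity
  obtain ⟨J, hJ⟩ := pow_unbounded_of_one_lt (K ^ 2) (show 1 < 1 + κ by linarith)
  -- The bounds on g make squares large compared with K, the vertical displacement negligible, and
  -- bad rows at most 1/16. Taking M = 2g keeps all steps in even columns.
  obtain ⟨g, hg⟩ := exists_nat_gt (max (max (64 * K * (K + 2)) (4 / κ)) (max 4 (16 * J)))
  simp only [max_lt_iff] at hg
  obtain ⟨⟨hg1, hg2⟩, hg3, hg4⟩ := hg
  have hg3' : 4 < g := by exact_mod_cast hg3
  have hg4' : 16 * J < g := by exact_mod_cast hg4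
  obtain ⟨M, hM⟩ : ∃ M, M = 2 * g := ⟨_, rfl⟩
  have hM0 : 0 < M := by omega
  obtain ⟨Y, hY⟩ := hr M
  -- After i descents the scale is M^(2j+1). Odd exponents leave room: a good strip lies within M *
  -- s rows, while the stretched pair is M² * s apart.
  have key : ∀ i j : ℕ, i + j = J → ∃ (m : ℤ) (n : ℕ), Even m ∧ n < M ^ (2 * J + 1) ∧
      (1 + κ) ^ i / K * (M ^ (2 * j + 1) : ℕ) ≤
        ‖G (m + (M ^ (2 * j + 1) : ℕ)) (Y + n) - G m (Y + n)‖ := by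
    intro i
    induction i with
    | zero =>
      intro j _
      refine ⟨0, 0, Even.zero, by positivity, ?_⟩
      have he : Even (0 + (M ^ (2 * j + 1) : ℕ) : ℤ) :=
        ⟨(g * M ^ (2 * j) : ℕ), by rw [pow_succ, hM]; push_cast; ring⟩
      have h1 := hG.abs_fst_le (Kept.of_even he (Y + (0 : ℕ))) (Kept.of_even Even.zero (Y + (0 : ℕ)))
      rw [zero_add, Int.cast_zero, sub_zero, Int.cast_natCast, Nat.abs_cast] at h1
      rw [pow_zero, zero_add, div_mul_eq_mul_div, one_mul, div_le_iff₀ hK0, mul_comm _ K]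
      exact h1
    | succ i ih =>
      intro j hij
      obtain ⟨m, n, hm, hn, hst⟩ := ih (j + 1) (by omega)
      obtain ⟨s, hs⟩ : ∃ s, s = M ^ (2 * j + 1) := ⟨_, rfl⟩
      have hMs : M ^ (2 * j + 2) = M * s := by rw [hs, ← pow_succ']
      have hT : M ^ (2 * (j + 1) + 1) = 2 * (2 * g ^ 2) * s := by
        rw [hs, show 2 * (j + 1) + 1 = 2 * j + 1 + 2 by ring, pow_add, hM]; ring
      have hs2 : s = 2 * (g * M ^ (2 * j)) := by rw [hs, pow_succ, hM]; ring
      have hMles : M ≤ s := hs ▸ Nat.le_self_pow (by omega) M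
      have hgM : (M : ℝ) = 2 * g := by rw [hM]; push_cast; ring
      have hsR : (0 : ℝ) < s := by exact_mod_cast hM0.trans_le hMles
      -- The first s rows of the block of M * s rows containing n form the strip of period mostly s.
      obtain ⟨q, hq⟩ : ∃ q, q = n / M ^ (2 * j + 2) := ⟨_, rfl⟩
      have hq1 : M ^ (2 * j + 2) * q ≤ n := by rw [hq]; exact Nat.mul_div_le _ _
      have hq2 : n < M ^ (2 * j + 2) * q + M ^ (2 * j + 2) := by
        rw [hq]; exact Nat.lt_mul_div_succ n (by positivity)
      have hq3 : M ^ (2 * j + 2) * q + M ^ (2 * j + 2) ≤ M ^ (2 * J + 1) := by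
        obtain ⟨k, hk⟩ := pow_dvd_pow M (show 2 * j + 2 ≤ 2 * J + 1 by omega)
        have : q < k := by
          rw [hq]; exact Nat.div_lt_of_lt_mul (hk ▸ hn)
        rw [hk, ← Nat.mul_succ]
        exact Nat.mul_le_mul_left _ this
      have hsle : s ≤ M ^ (2 * j + 2) := by rw [hMs]; exact Nat.le_mul_of_pos_left _ hM0
      have hJM : M ^ (2 * J + 1) ≤ M ^ (2 * M + 1) := Nat.pow_le_pow_right hM0 (by omega)
      rw [hT] at hst
      push_cast at hst
      obtain ⟨m', n', hm', hn1, hn2, hst'⟩ := hG.exists_more_stretched (D := 2 * s + M * s) hs2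
        (by
          have : (M : ℝ) ≤ s := by exact_mod_cast hMles
          linarith) (N := 2 * g ^ 2) (by positivity) hκ
        (A := (1 + κ) ^ i / K) (by positivity) (y := Y + (M ^ (2 * j + 2) * q : ℕ)) hm
        (by push_cast; exact hst) (by
          intro b hb
          have h1 : |(Y + (M ^ (2 * j + 2) * q : ℕ) + b : ℤ) - (Y + n)| ≤ (M * s : ℕ) := by
            rw [← hMs, abs_le]; omega
          have h2 : |((Y + (M ^ (2 * j + 2) * q : ℕ) + b : ℤ) : ℝ) - ((Y + n : ℤ) : ℝ)| ≤
              (M * s : ℕ) := by exact_mod_cast h1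
          push_cast at h2 ⊢
          linarith) (by
          rw [div_lt_iff₀ hκ0] at hg2
          push_cast
          rw [hgM]
          have h3 : (2 + 2 * g : ℝ) ≤ κ * (2 * g ^ 2) := by nlinarith
          nlinarith) (by
          have h1 := card_digitPeriod_ne_mul_le M j q
          rw [← hs] at h1
          have h2 : ((Finset.range s).filter fun b : ℕ =>
              r (Y + (M ^ (2 * j + 2) * q : ℕ) + b) ≠ s) =
              (Finset.range s).filter fun b => digitPeriod M (M ^ (2 * j + 2) * q + b) ≠ s := by
            refine Finset.filter_congr fun b hb => ?_
            rw [Finset.mem_range] at hb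
            rw [← hY _ (by omega : M ^ (2 * j + 2) * q + b < M ^ (2 * M + 1))]
            push_cast
            rw [add_assoc]
          rw [h2]
          refine le_of_mul_le_mul_right ?_ hM0
          calc _ = 16 * (((Finset.range s).filter fun b =>
                digitPeriod M (M ^ (2 * j + 2) * q + b) ≠ s).card * M) := by ring
            _ ≤ 16 * (j * s) := Nat.mul_le_mul_left _ h1
            _ = (16 * j) * s := by ring
            _ ≤ M * s := Nat.mul_le_mul_right _ (by omega)
            _ = s * M := mul_comm _ _)
      obtain ⟨n'', hn''⟩ := Int.eq_ofNat_of_zero_le (sub_nonneg.2 (by omega : Y ≤ n'))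
      have hnn : n' = Y + n'' := by omega
      refine ⟨m', n'', hm', by omega, ?_⟩
      rw [← hs, ← hnn]
      refine le_trans (le_of_eq ?_) hst'
      ring
  obtain ⟨m, n, hm, -, hst⟩ := key J 0 (by omega)
  rw [mul_zero, zero_add, pow_one] at hst
  have he : Even (m + M : ℤ) := hm.add ⟨g, by omega⟩
  have h1 := hG.norm_sub_le (Kept.of_even he (Y + n)) (Kept.of_even hm (Y + n))
  have hMR : (0 : ℝ) < M := by exact_mod_cast hM0
  have h2 : ((m + M : ℤ) : ℝ) - m = M := by push_cast; ring
  rw [h2, sub_self, abs_zero, add_zero, Nat.abs_cast] at h1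
  have h3 := le_of_mul_le_mul_right (hst.trans h1) hMR
  rw [div_le_iff₀ hK0, ← sq] at h3
  linarith

theorem theorem1 :
    ∃ X : Set (EuclideanSpace ℝ (Fin 2)),
      IsSeparatedNet X ∧ ¬ BiLipschitzEquivalent X integerLattice := by
  obtain ⟨r, hr⟩ := exists_word_containing digitPeriod fun M => M ^ (2 * M + 1)
  refine ⟨rowNet r, isSeparatedNet_rowNet r, fun h => ?_⟩
  obtain ⟨K, G, hG⟩ := exists_isLatticeParam h
  exact hG.false_of_digitPeriod hr
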